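/- Let $K/k$ be a Galois field extension of finite degree $\ell$ with cyclic Galois group generated by $\theta$, and let $B=(B_1,\dots,B_\ell)$ be a $k$-basis of $K$. For $x\in K$ let $\epsilon_B(x)\in k^{\ell\times 1}$ be the coordinate column of $x$ with respect to $B$, and for $c=(c_1,\dots,c_m)\in K^m$ let $\epsilon_B(c)\in k^{\ell\times m}$ be the matrix with columns $\epsilon_B(c_1),\dots,\epsilon_B(c_m)$. Let $m\ge 1$ and let $v=(v_1,\dots,v_m)\in K^m$ be a Gabidulin vector, i.e. the $k$-space $V_v:=\langle v_1,\dots,v_m\rangle_k\le K$ has dimension $m$, and suppose $v_1=1$. For $1\le d<m$ put $$\mathcal C(v,\theta,d):=\epsilon_B\bigl(\langle v,\theta(v),\dots,\theta^{d-1}(v)\rangle_K\bigr)\le k^{\ell\times m},$$ where $\theta$ acts on $K^m$ entrywise, and for a subspace $\mathcal C\le k^{\ell\times m}$ put $$\operatorname{Aut}(\mathcal C):=\{(g,h)\in \mathrm{GL}_\ell(k)\times\mathrm{GL}_m(k)\mid g^{-1}\mathcal C h=\mathcal C\}.$$ Let $M$, $k\le M\le K$, be the largest subfield such that $V_v$ is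 an $M$-linear subspace of $K$, let $F:=k[v_2,\dots,v_m]$, and let $s:=[K:F]$. Then $F$ is the smallest intermediate field of $K/k$ that contains $V_v$, the automorphism $\theta$ restricts to $F$ and $\operatorname{Gal}(F/k)=\langle\theta_{|F}\rangle$, and there is a subgroup $G\le\operatorname{Gal}(F/k)$ such that for every $1\le d<m$ $$\operatorname{Aut}(\mathcal C(v,\theta,d))\cong(\mathrm{GL}_s(F)\times M^\times).G,$$ that is, there is a short exact sequence of groups $$1\to \mathrm{GL}_s(F)\times M^\times\to\operatorname{Aut}(\mathcal C(v,\theta,d))\to G\to 1.$$ -/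

import Mathlib

namespace GabidulinLike

section Codes

variable {k K : Type*} [Field k] [Field K] [Algebra k K] {ℓ m : ℕ}

/-- The `k`-subspace `V_v = ⟨v_1, …, v_m⟩_k` of `K` spanned by the entries of `v`. -/
def entrySpan (k : Type*) {K : Type*} [Field k] [Field K] [Algebra k K] {m : ℕ}
    (v : Fin m → K) : Submodule k K :=
  Submodule.span k (Set.range v)

/-- The rank of `v ∈ K^m` is the `k`-dimension of `V_v`; `v` is a Gabidulin vector if its
rank equals `m`. -/
def IsGabidulinVector (k : Type*) {K : Type*} [Field k] [Field K] [Algebra k K] {m : ℕ}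
    (v : Fin m → K) : Prop :=
  Module.finrank k (entrySpan k v) = m

/-- The `K`-linear code `⟨v, θ(v), …, θ^{d-1}(v)⟩_K ≤ K^m`, with `θ` applied entrywise. -/
def vectorCode (v : Fin m → K) (θ : K ≃ₐ[k] K) (d : ℕ) : Submodule K (Fin m → K) :=
  Submodule.span K {w | ∃ j < d, w = fun i => (θ ^ j) (v i)}

/-- `ε_B` applied entrywise: the `j`-th column of `ε_B(c)` is the coordinate column of `c_j`
with respect to the `k`-basis `B` of `K`. -/
noncomputable def epsilon (B : Module.Basis (Fin ℓ) k K) : (Fin m → K) →ₗ[k] Matrix (Fin ℓ) (Fin m) k where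
  toFun c := Matrix.of fun i j => B.repr (c j) i
  map_add' c c' := by ext i j; simp
  map_smul' a c := by ext i j; simp

/-- The lifted code `ε_B(C) ≤ k^{ℓ × m}` of a `K`-linear code `C ≤ K^m`. -/
noncomputable def liftedCode (B : Module.Basis (Fin ℓ) k K) (C : Submodule K (Fin m → K)) :
    Submodule k (Matrix (Fin ℓ) (Fin m) k) :=
  (C.restrictScalars k).map (epsilon B)

/-- The code `C(v, θ, d) ≤ k^{ℓ × m}`. -/
noncomputable def code (B : Module.Basis (Fin ℓ) k K) (v : Fin m → K) (θ : K ≃ₐ[k] K) (d : ℕ) :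
    Submodule k (Matrix (Fin ℓ) (Fin m) k) :=
  liftedCode B (vectorCode v θ d)

/-- The map `X ↦ g⁻¹ X h` on `k^{ℓ × m}`. -/
def kappa (p : GL (Fin ℓ) k × GL (Fin m) k) (X : Matrix (Fin ℓ) (Fin m) k) :
    Matrix (Fin ℓ) (Fin m) k :=
  ((p.1⁻¹ : GL (Fin ℓ) k) : Matrix (Fin ℓ) (Fin ℓ) k) * X * (p.2 : Matrix (Fin m) (Fin m) k)

theorem kappa_one (X : Matrix (Fin ℓ) (Fin m) k) : kappa 1 X = X := by
  simp [kappa]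

theorem kappa_mul (p q : GL (Fin ℓ) k × GL (Fin m) k) (X : Matrix (Fin ℓ) (Fin m) k) :
    kappa (p * q) X = kappa q (kappa p X) := by
  simp only [kappa, Prod.fst_mul, Prod.snd_mul, mul_inv_rev, Units.val_mul, Matrix.mul_assoc]

/-- The (proper) automorphism group
`Aut(C) = {(g, h) ∈ GL_ℓ(k) × GL_m(k) | g⁻¹ C h = C}` of a code `C ≤ k^{ℓ × m}`. -/
def codeAut (C : Submodule k (Matrix (Fin ℓ) (Fin m) k)) :
    Subgroup (GL (Fin ℓ) k × GL (Fin m) k) where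
  carrier := {p | kappa p '' (C : Set (Matrix (Fin ℓ) (Fin m) k)) = C}
  one_mem' := by
    have h : kappa (1 : GL (Fin ℓ) k × GL (Fin m) k) = id := funext kappa_one
    simp [h]
  mul_mem' := by
    intro p q hp hq
    have h : kappa (p * q) = kappa q ∘ kappa p := funext (kappa_mul p q)
    simp only [Set.mem_ofPred_eq] at hp hq ⊢
    rw [h, Set.image_comp, hp, hq]
  inv_mem' := by
    intro p hp
    simp only [Set.mem_ofPred_eq] at hp ⊢
    have h : kappa p⁻¹ ∘ kappa p = id := by
      funext X
      rw [Function.comp_apply, ← kappa_mul, mul_inv_cancel, kappa_one, id]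
    conv_lhs => rw [← hp]
    rw [← Set.image_comp, h, Set.image_id]

end Codes

end GabidulinLike

/-! Read g as a k-endomorphism γ of K and put w = vh. By a dimension count, (g, h) is an
automorphism iff γ, applied entrywise, maps the code of v into the code of w
(`mem_codeAut_iff_forall_mem`). Expand γ = ∑ a_σ σ over Gal(K/k). Linear independence of
automorphisms (`forall_mem_of_forall_sum_mem`) puts the first d conjugates of σ(v) into the code of
w whenever a_σ ≠ 0. Since d < m, comparing leading terms then makes σ(v) a multiple of w
(`exists_eq_mul_of_conj_mem`); this rests on the fact that a nonzero θ-polynomial of degree n has at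
most an n-dimensional space of zeros (`coeff_eq_zero_of_forall_mem`). As the first entry of v is 1,
all σ in the support of γ agree on v, hence on F, so γ is semilinear over F and w = bσ(v).
Conversely, such pairs are automorphisms because Gal(K/k) is abelian (`mem_codeAut_iff`).

This criterion does not involve d, so one G serves for all d. Sending a pair to σ on F is a
homomorphism. Its image G consists of the σ with bσ(V_v) = V_v for some b ≠ 0 in F. In its kernel, g
is an arbitrary F-linear automorphism of K and h is multiplication on V_v by some b, which lies in M
by maximality; this is GL_s(F) × Mˣ. -/

namespace GabidulinLike

open Finset

variable {k K : Type*} [Field k] [Field K] [Algebra k K] {ℓ m : ℕ}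

/-! ### Zeros of θ-polynomials. -/

/-- Summation by parts for a sequence of coefficients `c` and its partial sums. -/
theorem sum_partialSum_mul_sub (c y : ℕ → K) (N : ℕ) :
    ∑ j ∈ range N, (∑ i ∈ range (j + 1), c i) * (y (j + 1) - y j) =
      (∑ i ∈ range (N + 1), c i) * y N - ∑ j ∈ range (N + 1), c j * y j := by
  induction N with
  | zero => simp
  | succ N ih =>
    rw [sum_range_succ, ih, sum_range_succ c (N + 1), sum_range_succ (fun j => c j * y j) (N + 1)]
    ring

/-- A `θ`-polynomial of degree at most `n` that vanishes on a `k`-space of dimension greater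
than `n` is zero, if the fixed field of `θ` is `k`. -/
theorem coeff_eq_zero_of_forall_mem [FiniteDimensional k K] {θ : K ≃ₐ[k] K}
    (hθ : ∀ x, θ x = x → x ∈ Set.range (algebraMap k K)) (n : ℕ) :
    ∀ (c : ℕ → K) (W : Submodule k K), n < Module.finrank k W →
      (∀ x ∈ W, ∑ j ∈ range (n + 1), c j * (θ ^ j) x = 0) → ∀ j ≤ n, c j = 0 := by
  induction n with
  | zero =>
    intro c W hW h j hj
    obtain ⟨w, hw, hw0⟩ := W.ne_bot_iff.1 (fun h0 => by rw [h0, finrank_bot] at hW; omega)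
    obtain rfl : j = 0 := by omega
    have := h w hw
    simpa [hw0] using this
  | succ n ih =>
    intro c W hW h
    obtain ⟨w, hw, hw0⟩ := W.ne_bot_iff.1 (fun h0 => by rw [h0, finrank_bot] at hW; omega)
    -- Divide the θ-polynomial by its zero w: T kills exactly the line kw, as θ fixes only k, so
    -- T(W) loses at most one dimension.
    let T : K →ₗ[k] K := (θ.toLinearMap - LinearMap.id) ∘ₗ LinearMap.mulLeft k w⁻¹
    have hT : ∀ x, T x = θ (w⁻¹ * x) - w⁻¹ * x := fun x => rfl
    have hker : Module.finrank k (LinearMap.ker (T.domRestrict W)) ≤ 1 := by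
      refine finrank_le_one ⟨⟨w, hw⟩, by simp [hT, hw0]⟩ ?_
      rintro ⟨⟨x, hx⟩, hxT⟩
      have hxT' : T x = 0 := hxT
      rw [hT, sub_eq_zero] at hxT'
      obtain ⟨a, ha⟩ := hθ _ hxT'
      refine ⟨a, ?_⟩
      ext
      simp only [SetLike.mk_smul_mk, Algebra.smul_def, ha]
      field_simp
    have hdim : n < Module.finrank k (W.map T) := by
      have h1 := LinearMap.finrank_range_add_finrank_ker (T.domRestrict W)
      rw [LinearMap.range_domRestrict] at h1
      omega
    set c' : ℕ → K := fun j => c j * (θ ^ j) w with hc'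
    have hsum : ∑ j ∈ range (n + 1 + 1), c' j = 0 := h w hw
    -- With P the θ-polynomial, summation by parts gives P(x) = -∑ C_j θ^j(Tx), where C_j are the
    -- partial sums of c'. The boundary term vanishes because the full sum of c' is P(w) = 0.
    have hQ := ih (fun j => ∑ i ∈ range (j + 1), c' i) (W.map T) hdim (by
      rintro _ ⟨x, hx, rfl⟩
      have h2 := sum_partialSum_mul_sub c' (fun j => (θ ^ j) (w⁻¹ * x)) (n + 1)
      rw [hsum, zero_mul, zero_sub] at h2
      have h3 : ∑ j ∈ range (n + 1 + 1), c' j * (θ ^ j) (w⁻¹ * x) = 0 := by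
        rw [← h x hx]
        refine sum_congr rfl fun j _ => ?_
        rw [hc', mul_assoc, ← map_mul, mul_inv_cancel_left₀ hw0]
      rw [h3, neg_zero] at h2
      rw [← h2]
      refine sum_congr rfl fun j _ => ?_
      rw [hT, map_sub, pow_succ, AlgEquiv.mul_apply])
    have hQ' : ∀ j ≤ n + 1, ∑ i ∈ range (j + 1), c' i = 0 := by
      intro j hj
      rcases Nat.lt_or_ge n j with h4 | h4
      · obtain rfl : j = n + 1 := by omega
        exact hsum
      · exact hQ j h4
    intro j hj
    have h5 : c' j = 0 := by
      have h6 := hQ' j hj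
      rw [sum_range_succ] at h6
      rcases j with _ | j
      · simpa using h6
      · rwa [hQ' j (by omega), zero_add] at h6
    exact (mul_eq_zero.1 h5).resolve_right ((map_ne_zero (θ ^ j)).2 hw0)

/-- The conjugates `w, θ(w), …, θ^{m-1}(w)` of a Gabidulin vector are `K`-linearly independent. -/
theorem coeff_eq_zero_of_sum_conj_eq_zero [FiniteDimensional k K] {θ : K ≃ₐ[k] K}
    (hθ : ∀ x, θ x = x → x ∈ Set.range (algebraMap k K)) {w : Fin m → K}
    (hw : IsGabidulinVector k w) {n : ℕ} (hn : n < m) {c : ℕ → K}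
    (h : ∀ i, ∑ j ∈ range (n + 1), c j * (θ ^ j) (w i) = 0) : ∀ j ≤ n, c j = 0 := by
  refine coeff_eq_zero_of_forall_mem hθ n c (entrySpan k w) (by rwa [hw]) ?_
  let T : K →ₗ[k] K := ∑ j ∈ range (n + 1), LinearMap.mulLeft k (c j) ∘ₗ (θ ^ j).toLinearMap
  have hT : ∀ x, T x = ∑ j ∈ range (n + 1), c j * (θ ^ j) x := fun x => by simp [T]
  have : entrySpan k w ≤ LinearMap.ker T := by
    refine Submodule.span_le.2 ?_
    rintro _ ⟨i, rfl⟩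
    simpa [hT] using h i
  intro x hx
  rw [← hT]
  exact this hx

/-! ### Conjugates inside a Gabidulin code. -/

theorem mem_vectorCode_iff {v : Fin m → K} {θ : K ≃ₐ[k] K} {d : ℕ} {x : Fin m → K} :
    x ∈ vectorCode v θ d ↔
      ∃ a : ℕ → K, ∀ i, x i = ∑ j ∈ range d, a j * (θ ^ j) (v i) := by
  have : {w | ∃ j < d, w = fun i => (θ ^ j) (v i)} =
      (fun (j : ℕ) i => (θ ^ j) (v i)) '' (range d : Set ℕ) := by
    ext w
    simp [eq_comm]
  rw [vectorCode, this, Submodule.mem_span_image_finset_iff_exists_fun]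
  constructor
  · rintro ⟨c, rfl⟩
    refine ⟨fun j => if h : j ∈ range d then c ⟨j, h⟩ else 0, fun i => ?_⟩
    rw [← sum_coe_sort (range d), Finset.sum_apply]
    exact sum_congr rfl fun j _ => by simp
  · rintro ⟨a, ha⟩
    refine ⟨fun j => a j, funext fun i => ?_⟩
    rw [ha, ← sum_coe_sort (range d), Finset.sum_apply]
    rfl

theorem conj_mem_vectorCode (v : Fin m → K) (θ : K ≃ₐ[k] K) {d j : ℕ} (hj : j < d) :
    (fun i => (θ ^ j) (v i)) ∈ vectorCode v θ d :=
  Submodule.subset_span ⟨j, hj, rfl⟩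

/-- If `x, θ(x), …, θ^{d-1}(x)` all lie in the code of a Gabidulin vector `w`, then `x` is a
multiple of `w`. -/
theorem exists_eq_mul_of_conj_mem [FiniteDimensional k K] {θ : K ≃ₐ[k] K}
    (hθ : ∀ x, θ x = x → x ∈ Set.range (algebraMap k K)) {w : Fin m → K}
    (hw : IsGabidulinVector k w) {d : ℕ} (hd : 1 ≤ d) (hdm : d < m) {x : Fin m → K}
    (hx : ∀ j < d, (fun i => (θ ^ j) (x i)) ∈ vectorCode w θ d) :
    ∃ a : K, ∀ i, x i = a * w i := by
  obtain ⟨a, ha⟩ := mem_vectorCode_iff.1 (hx 0 hd)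
  simp only [pow_zero, AlgEquiv.one_apply] at ha
  have key : ∀ j, 1 ≤ j → j < d → a j = 0 := by
    by_contra! hcon
    have hex : ∃ e, 1 ≤ e ∧ e < d ∧ a (d - e) ≠ 0 := by
      obtain ⟨j, h1, h2, h3⟩ := hcon
      exact ⟨d - j, by omega, by omega, by rwa [Nat.sub_sub_self h2.le]⟩
    -- `d - e` is the top index `≥ 1` of a nonzero coefficient of `x`
    classical
    obtain ⟨he1, he2, he3⟩ := Nat.find_spec hex
    have hmin := fun t (ht : t < Nat.find hex) => Nat.find_min hex ht
    set e := Nat.find hex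
    obtain ⟨b, hb⟩ := mem_vectorCode_iff.1 (hx e he2)
    -- Two expansions of θ^e(x): shifting that of x gives degree d with leading coefficient θ^e(a (d
    -- - e)), while membership in the code gives degree below d. Their difference is a relation of
    -- degree d < m, so it must be trivial.
    have hrel : ∀ i, ∑ j ∈ range (d + 1),
        ((if e ≤ j then (θ ^ e) (a (j - e)) else 0) - (if j < d then b j else 0)) *
          (θ ^ j) (w i) = 0 := by
      intro i
      have h1 : ∑ j ∈ range (d + 1), (if j < d then b j else 0) * (θ ^ j) (w i) =
          (θ ^ e) (x i) := by
        rw [sum_range_succ, hb i]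
        simp only [lt_irrefl, if_false, zero_mul, add_zero]
        exact sum_congr rfl fun j hj => by rw [if_pos (mem_range.1 hj)]
      have h2 : ∑ j ∈ range (d + 1), (if e ≤ j then (θ ^ e) (a (j - e)) else 0) *
          (θ ^ j) (w i) = (θ ^ e) (x i) := by
        have hsplit : ∑ j ∈ range d, a j * (θ ^ j) (w i) =
            ∑ j ∈ range (d + 1 - e), a j * (θ ^ j) (w i) := by
          refine (sum_subset (range_subset_range.2 (by omega)) fun j hj hj' => ?_).symm
          simp only [mem_range, not_lt] at hj hj'
          by_contra hne
          refine hmin (d - j) (by omega) ⟨by omega, by omega, fun h0 => hne ?_⟩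
          rw [Nat.sub_sub_self hj.le] at h0
          rw [h0, zero_mul]
        rw [ha i, hsplit, map_sum]
        have hde : d + 1 = e + (d + 1 - e) := by omega
        rw [hde, sum_range_add, sum_eq_zero, zero_add]
        · rw [← hde]
          refine sum_congr rfl fun j _ => ?_
          rw [if_pos (by omega), Nat.add_sub_cancel_left, map_mul, pow_add, AlgEquiv.mul_apply]
        · intro j hj
          rw [if_neg (by simpa using hj), zero_mul]
      simp only [sub_mul, sum_sub_distrib, h1, h2, sub_self]
    have h0 := coeff_eq_zero_of_sum_conj_eq_zero hθ hw hdm hrel d le_rfl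
    simp only [he2.le, if_true, lt_irrefl, if_false, sub_zero] at h0
    exact he3 ((map_eq_zero (θ ^ e)).1 h0)
  refine ⟨a 0, fun i => ?_⟩
  rw [ha i, sum_eq_single 0]
  · simp
  · intro j hj hj0
    rw [key j (by omega) (mem_range.1 hj), zero_mul]
  · intro h
    exact absurd (mem_range.2 hd) h

/-! ### Endomorphisms as combinations of automorphisms. -/

theorem linearIndependent_algEquiv_toLinearMap (k K : Type*) [Field k] [Field K] [Algebra k K]
    [FiniteDimensional k K] :
    LinearIndependent K (fun σ : K ≃ₐ[k] K => (σ.toAlgHom.toLinearMap : K →ₗ[k] K)) :=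
  (linearIndependent_algHom_toLinearMap k K K).comp _ (algEquivEquivAlgHom k K).injective

/-- Every `k`-endomorphism of a finite Galois extension is a `K`-combination of
automorphisms. -/
theorem exists_eq_sum_algEquiv [FiniteDimensional k K] [IsGalois k K] (γ : K →ₗ[k] K) :
    ∃ a : (K ≃ₐ[k] K) → K, ∀ y, γ y = ∑ σ, a σ * σ y := by
  have hli := linearIndependent_algEquiv_toLinearMap k K
  -- Both sides equal [K:k], so the independent family of automorphisms is a K-basis.
  have hcard : Fintype.card (K ≃ₐ[k] K) = Module.finrank K (K →ₗ[k] K) := by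
    rw [Module.finrank_linearMap_self, ← Nat.card_eq_fintype_card, IsGalois.card_aut_eq_finrank]
  have hspan := hli.span_eq_top_of_card_eq_finrank' hcard
  have hγ : γ ∈ Submodule.span K (Set.range fun σ : K ≃ₐ[k] K => (σ.toAlgHom.toLinearMap : K →ₗ[k] K)) := by
    rw [hspan]
    trivial
  obtain ⟨a, ha⟩ := (Submodule.mem_span_range_iff_exists_fun K).1 hγ
  exact ⟨a, fun y => by simp [← ha]⟩

/-- If all `K`-combinations `∑ σ(y) u_σ` lie in a subspace, then so do the `u_σ`. -/
theorem forall_mem_of_forall_sum_mem [FiniteDimensional k K] {C : Submodule K (Fin m → K)}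
    {u : (K ≃ₐ[k] K) → Fin m → K} (h : ∀ y, ∑ σ, σ y • u σ ∈ C) (σ : K ≃ₐ[k] K) : u σ ∈ C := by
  by_contra hσ
  -- A functional killing C but not u σ turns the hypothesis into a nontrivial K-linear relation
  -- between the automorphisms.
  obtain ⟨f, hf, hfC⟩ := Submodule.exists_dual_map_eq_bot_of_notMem hσ inferInstance
  have hli := linearIndependent_algEquiv_toLinearMap k K
  refine hf (Fintype.linearIndependent_iff.1 hli (fun σ => f (u σ)) ?_ σ)
  ext y
  have : f (∑ σ, σ y • u σ) = 0 := by
    rw [← Submodule.mem_bot K, ← hfC]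
    exact Submodule.mem_map_of_mem (h y)
  simpa [mul_comm] using this

/-! ### Matrix actions carried over to K^m. -/

/-- The right action `c ↦ c h` of a matrix over `k` on `K^m`. -/
def rightMul (K : Type*) [Field K] [Algebra k K] (H : Matrix (Fin m) (Fin m) k) :
    (Fin m → K) →ₗ[K] (Fin m → K) where
  toFun c j := ∑ i, H i j • c i
  map_add' c c' := by ext j; simp [sum_add_distrib]
  map_smul' a c := by ext j; simp [mul_sum]

theorem rightMul_apply (H : Matrix (Fin m) (Fin m) k) (c : Fin m → K) (j : Fin m) :
    rightMul K H c j = ∑ i, H i j • c i := rfl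

theorem epsilon_injective (B : Module.Basis (Fin ℓ) k K) :
    Function.Injective (epsilon B : (Fin m → K) →ₗ[k] Matrix (Fin ℓ) (Fin m) k) := by
  intro c c' h
  ext j
  refine B.repr.injective (Finsupp.ext fun i => ?_)
  exact congrFun (congrFun h i) j

theorem mul_epsilon (B : Module.Basis (Fin ℓ) k K) (A : Matrix (Fin ℓ) (Fin ℓ) k)
    (c : Fin m → K) :
    A * epsilon B c = epsilon B (fun i => Matrix.toLinAlgEquiv B A (c i)) := by
  ext i j
  have h : B.repr (Matrix.toLinAlgEquiv B A (c j)) = A.mulVec (B.repr (c j)) := by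
    rw [Matrix.toLinAlgEquiv_apply, B.repr_sum_self]
  exact (congrFun h i).symm

theorem epsilon_mul (B : Module.Basis (Fin ℓ) k K) (H : Matrix (Fin m) (Fin m) k)
    (c : Fin m → K) : epsilon B c * H = epsilon B (rightMul K H c) := by
  ext i j
  simp [epsilon, Matrix.mul_apply, rightMul_apply, map_sum, mul_comm]

theorem conj_rightMul (H : Matrix (Fin m) (Fin m) k) (c : Fin m → K) (τ : K ≃ₐ[k] K) :
    (fun j => τ (rightMul K H c j)) = rightMul K H (fun i => τ (c i)) := by
  ext j
  simp [rightMul_apply]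

/-- The entries of H lie in k and are fixed by θ, so right multiplication commutes with conjugation.
-/
theorem vectorCode_rightMul (H : Matrix (Fin m) (Fin m) k) (v : Fin m → K) (θ : K ≃ₐ[k] K)
    (d : ℕ) : vectorCode (rightMul K H v) θ d = (vectorCode v θ d).map (rightMul K H) := by
  rw [vectorCode, vectorCode, Submodule.map_span]
  congr 1
  ext w
  constructor
  · rintro ⟨j, hj, rfl⟩
    exact ⟨_, ⟨j, hj, rfl⟩, (conj_rightMul H v (θ ^ j)).symm⟩
  · rintro ⟨_, ⟨j, hj, rfl⟩, rfl⟩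
    exact ⟨j, hj, (conj_rightMul H v (θ ^ j)).symm⟩

/-- `kappa p` as a linear map. -/
def kappaLin (p : GL (Fin ℓ) k × GL (Fin m) k) :
    Matrix (Fin ℓ) (Fin m) k →ₗ[k] Matrix (Fin ℓ) (Fin m) k where
  toFun := kappa p
  map_add' X Y := by simp [kappa, Matrix.mul_add, Matrix.add_mul]
  map_smul' a X := by simp [kappa]

/-- A pair `(g, h)` is an automorphism of `C(v, θ, d)` if and only if `g` maps the code of `v`
into the code of `v h`. -/
theorem mem_codeAut_iff_forall_mem (B : Module.Basis (Fin ℓ) k K) (v : Fin m → K)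
    (θ : K ≃ₐ[k] K) (d : ℕ) (p : GL (Fin ℓ) k × GL (Fin m) k) :
    p ∈ codeAut (code B v θ d) ↔ ∀ c ∈ vectorCode v θ d,
      (fun i => Matrix.toLinAlgEquiv B (p.1 : Matrix (Fin ℓ) (Fin ℓ) k) (c i)) ∈
        vectorCode (rightMul K (p.2 : Matrix (Fin m) (Fin m) k) v) θ d := by
  have hmem : ∀ X, X ∈ code B v θ d ↔ ∃ c ∈ vectorCode v θ d, epsilon B c = X := fun X => Iff.rfl
  rw [vectorCode_rightMul]
  constructor
  · intro hp c hc
    have h1 : epsilon B c ∈ (code B v θ d : Set (Matrix (Fin ℓ) (Fin m) k)) := ⟨c, hc, rfl⟩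
    have hp' : kappa p '' (code B v θ d : Set (Matrix (Fin ℓ) (Fin m) k)) = code B v θ d := hp
    rw [← hp'] at h1
    obtain ⟨_, ⟨c', hc', rfl⟩, h2⟩ := h1
    refine ⟨c', hc', epsilon_injective B ?_⟩
    rw [← epsilon_mul, ← mul_epsilon, ← h2]
    simp [kappa, Matrix.mul_assoc]
  · intro h
    -- The inclusion gC ⊆ Ch says C ⊆ g⁻¹Ch; equality follows since the right side has no larger
    -- dimension.
    have hle : code B v θ d ≤ (code B v θ d).map (kappaLin p) := by
      rintro _ ⟨c, hc, rfl⟩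
      obtain ⟨c', hc', h2⟩ := h c hc
      refine ⟨epsilon B c', ⟨c', hc', rfl⟩, ?_⟩
      have h3 : epsilon B c' * (p.2 : Matrix (Fin m) (Fin m) k) =
          (p.1 : Matrix (Fin ℓ) (Fin ℓ) k) * epsilon B c := by
        rw [epsilon_mul, mul_epsilon, h2]
      change kappa p _ = _
      rw [kappa, Matrix.mul_assoc, h3, ← Matrix.mul_assoc]
      simp
    have heq := Submodule.eq_of_le_of_finrank_le hle (Submodule.finrank_map_le _ _)
    change kappa p '' (code B v θ d : Set (Matrix (Fin ℓ) (Fin m) k)) = code B v θ d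
    conv_rhs => rw [heq]
    rfl

theorem isGabidulinVector_iff {v : Fin m → K} :
    IsGabidulinVector k v ↔ LinearIndependent k v := by
  rw [linearIndependent_iff_card_eq_finrank_span, Fintype.card_fin, eq_comm]
  rfl

theorem IsGabidulinVector.rightMul {v : Fin m → K} (hv : IsGabidulinVector k v)
    (h : GL (Fin m) k) :
    IsGabidulinVector k (rightMul K (h : Matrix (Fin m) (Fin m) k) v) := by
  rw [isGabidulinVector_iff] at hv ⊢
  rw [Fintype.linearIndependent_iff] at hv ⊢
  intro g hg
  have h1 : (h : Matrix (Fin m) (Fin m) k).mulVec g = 0 := by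
    ext i
    refine hv _ ?_ i
    rw [← hg]
    simp only [Matrix.mulVec, dotProduct, rightMul_apply, sum_smul, smul_sum]
    rw [sum_comm]
    refine sum_congr rfl fun j _ => sum_congr rfl fun i _ => ?_
    rw [smul_smul, mul_comm]
  have h2 : ((h⁻¹ : GL (Fin m) k) : Matrix (Fin m) (Fin m) k).mulVec
      ((h : Matrix (Fin m) (Fin m) k).mulVec g) = g := by
    rw [Matrix.mulVec_mulVec, ← Units.val_mul, inv_mul_cancel, Units.val_one, Matrix.one_mulVec]
  rw [h1, Matrix.mulVec_zero] at h2
  exact fun i => congrFun h2.symm i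

/-! ### Automorphisms as semilinear pairs. -/

/-- The endomorphism `g` of `K` is `σ`-semilinear over `F`. -/
def IsSemilinear {F : IntermediateField k K} (B : Module.Basis (Fin ℓ) k K) (g : GL (Fin ℓ) k)
    (σ : F ≃ₐ[k] F) : Prop :=
  ∀ (x : F) (y : K), Matrix.toLinAlgEquiv B (g : Matrix (Fin ℓ) (Fin ℓ) k) (x * y) =
    σ x * Matrix.toLinAlgEquiv B (g : Matrix (Fin ℓ) (Fin ℓ) k) y

/-- `p = (g, h)` acts semilinearly: `g` is `σ`-semilinear over `F`, and `h` maps `v` to a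
multiple of `σ(v)`. -/
def IsSemilinearPair {F : IntermediateField k K} (B : Module.Basis (Fin ℓ) k K) {v : Fin m → K}
    (hvF : ∀ i, v i ∈ F) (p : GL (Fin ℓ) k × GL (Fin m) k) (σ : F ≃ₐ[k] F) : Prop :=
  IsSemilinear B p.1 σ ∧ ∃ b : F, b ≠ 0 ∧
    ∀ i, rightMul K (p.2 : Matrix (Fin m) (Fin m) k) v i = b * σ ⟨v i, hvF i⟩

/-- The automorphisms of `C(v, θ, d)` are the semilinear pairs, for every `1 ≤ d < m`. -/
theorem mem_codeAut_iff [FiniteDimensional k K] [IsAbelianGalois k K] [NeZero m]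
    (B : Module.Basis (Fin ℓ) k K) {θ : K ≃ₐ[k] K}
    (hθ : ∀ x, θ x = x → x ∈ Set.range (algebraMap k K))
    {v : Fin m → K} (hv : IsGabidulinVector k v) (hv1 : v 0 = 1)
    {F : IntermediateField k K} (hF : F.toSubalgebra = Algebra.adjoin k (Set.range v))
    (hvF : ∀ i, v i ∈ F)
    {d : ℕ} (hd : 1 ≤ d) (hdm : d < m) (p : GL (Fin ℓ) k × GL (Fin m) k) :
    p ∈ codeAut (code B v θ d) ↔ ∃ σ : F ≃ₐ[k] F, IsSemilinearPair B hvF p σ := by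
  have hcomm : ∀ (σ τ : K ≃ₐ[k] K) x, σ (τ x) = τ (σ x) := fun σ τ x =>
    DFunLike.congr_fun (IsMulCommutative.is_comm.comm σ τ) x
  rw [mem_codeAut_iff_forall_mem]
  set γ := Matrix.toLinAlgEquiv B (p.1 : Matrix (Fin ℓ) (Fin ℓ) k) with hγ
  set w := rightMul K (p.2 : Matrix (Fin m) (Fin m) k) v with hw
  constructor
  · intro h
    obtain ⟨a, ha⟩ := exists_eq_sum_algEquiv γ
    have hsupp : ∀ σ, a σ ≠ 0 → ∃ c, ∀ i, σ (v i) = c * w i := by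
      intro σ hσ
      refine exists_eq_mul_of_conj_mem hθ (hv.rightMul p.2) hd hdm fun j hj => ?_
      -- γ(y θ^j(v)) = ∑ σ(y) a_σ σ(θ^j(v)) lies in the code of w for every y, so each summand
      -- vector does.
      have h1 := forall_mem_of_forall_sum_mem (C := vectorCode w θ d)
        (u := fun σ i => a σ * σ ((θ ^ j) (v i))) (fun y => by
          convert h _ (Submodule.smul_mem _ y (conj_mem_vectorCode v θ hj)) using 1
          ext i
          rw [Finset.sum_apply, ha]
          refine sum_congr rfl fun σ _ => ?_
          simp only [Pi.smul_apply, smul_eq_mul, map_mul]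
          ring) σ
      convert Submodule.smul_mem _ (a σ)⁻¹ h1 using 1
      ext i
      simp only [Pi.smul_apply, smul_eq_mul]
      rw [inv_mul_cancel_left₀ hσ, hcomm]
    -- The normalization `v 0 = 1` fixes the multiplier as `w 0`, which does not depend on σ.
    have hw0 : ∀ σ, a σ ≠ 0 → w 0 ≠ 0 ∧ ∀ i, w i = w 0 * σ (v i) := by
      intro σ hσ
      obtain ⟨c, hc⟩ := hsupp σ hσ
      have h0 := hc 0
      rw [hv1, map_one] at h0
      have h1 : w 0 ≠ 0 := by
        rintro h2
        simp [h2] at h0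
      refine ⟨h1, fun i => ?_⟩
      rw [hc i, ← mul_assoc, mul_comm (w 0) c, ← h0, one_mul]
    obtain ⟨σ, hσ⟩ : ∃ σ, a σ ≠ 0 := by
      by_contra! hcon
      have h1 : γ = 0 := by
        ext y
        simp [ha, hcon]
      have h2 : (p.1 : Matrix (Fin ℓ) (Fin ℓ) k) = 0 := by
        rwa [hγ, map_eq_zero_iff _ (AlgEquiv.injective _)] at h1
      have h3 : IsEmpty (Fin ℓ) := by
        by_contra hne
        rw [not_isEmpty_iff] at hne
        exact p.1.ne_zero h2
      have := Module.finrank_eq_card_basis B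
      rw [Fintype.card_eq_zero] at this
      exact Module.finrank_pos.ne' this
    have hagree : ∀ τ, a τ ≠ 0 → ∀ x ∈ F, τ x = σ x := by
      intro τ hτ
      have hle : F.toSubalgebra ≤ AlgHom.equalizer τ.toAlgHom σ.toAlgHom := by
        rw [hF, Algebra.adjoin_le_iff]
        rintro _ ⟨i, rfl⟩
        have h1 := (hw0 τ hτ).2 i
        rw [(hw0 σ hσ).2 i] at h1
        exact (mul_left_cancel₀ (hw0 σ hσ).1 h1).symm
      exact fun x hx => hle hx
    have hres : ∀ x : F, ((σ.restrictNormal F) x : K) = σ x := σ.restrictNormal_commutes F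
    have hwF : w 0 ∈ F := by
      rw [hw, rightMul_apply]
      exact sum_mem fun i _ => F.smul_mem (hvF i)
    refine ⟨σ.restrictNormal F, fun x y => ?_, ⟨w 0, hwF⟩, ?_, fun i => ?_⟩
    · rw [← hγ, ha, ha, hres, mul_sum]
      refine sum_congr rfl fun τ _ => ?_
      by_cases hτ : a τ = 0
      · simp [hτ]
      · rw [map_mul, hagree τ hτ x x.2]
        ring
    · intro h0
      exact (hw0 σ hσ).1 (congrArg Subtype.val h0)
    · rw [hres]
      exact (hw0 σ hσ).2 i
  · rintro ⟨σ, hσ, b, hb, hbw⟩ c hc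
    obtain ⟨a, ha⟩ := mem_vectorCode_iff.1 hc
    have hσK : ∀ x : F, (σ x : K) = σ.liftNormal K x := fun x => (σ.liftNormal_commutes K x).symm
    -- By semilinearity and commutativity, γ(a_j θ^j(v_i)) = γ(a_j) θ^j(σ(v_i)), and σ(v_i) = b⁻¹
    -- w_i.
    refine mem_vectorCode_iff.2 ⟨fun j => γ (a j) * ((θ ^ j) b)⁻¹, fun i => ?_⟩
    rw [ha i, map_sum]
    refine sum_congr rfl fun j _ => ?_
    have hθF : (θ ^ j) (v i) = ((θ ^ j).restrictNormal F ⟨v i, hvF i⟩ : F) :=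
      ((θ ^ j).restrictNormal_commutes F ⟨v i, hvF i⟩).symm
    have hb0 : (θ ^ j) (b : K) ≠ 0 := (map_ne_zero (θ ^ j)).2 (by simpa using hb)
    rw [mul_comm (a j), hθF, hσ, hσK, ← hθF, hw, hbw, hσK, map_mul, hcomm, ← hγ]
    field_simp

/-! ### Matrices of endomorphisms and the stabilizing field M. -/

theorem exists_GL_toLinAlgEquiv_eq {k V ι : Type*} [Field k] [AddCommGroup V] [Module k V]
    [Fintype ι] [DecidableEq ι] (B : Module.Basis ι k V) (f : V →ₗ[k] V)
    (hf : Function.Injective f) :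
    ∃ g : GL ι k, Matrix.toLinAlgEquiv B (g : Matrix ι ι k) = f := by
  have : FiniteDimensional k V := B.finiteDimensional_of_finite
  have hu : IsUnit f := f.isUnit_iff_ker_eq_bot.2 (LinearMap.ker_eq_bot.2 hf)
  obtain ⟨g, hg⟩ := hu.map (LinearMap.toMatrixAlgEquiv B)
  exact ⟨g, by rw [hg, Matrix.toLinAlgEquiv_toMatrixAlgEquiv]⟩

theorem toLinAlgEquiv_injective {k V ι : Type*} [Field k] [AddCommGroup V] [Module k V]
    [Fintype ι] [DecidableEq ι] (B : Module.Basis ι k V) (g : GL ι k) :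
    Function.Injective (Matrix.toLinAlgEquiv B (g : Matrix ι ι k)) := by
  refine Function.LeftInverse.injective
    (g := Matrix.toLinAlgEquiv B ((g⁻¹ : GL ι k) : Matrix ι ι k)) fun x => ?_
  rw [← Module.End.mul_apply, ← map_mul, ← Units.val_mul, inv_mul_cancel, Units.val_one, map_one,
    Module.End.one_apply]

/-- The entries of a Gabidulin vector as a basis of their span. -/
noncomputable def IsGabidulinVector.basis {v : Fin m → K} (hv : IsGabidulinVector k v) :
    Module.Basis (Fin m) k (entrySpan k v) :=
  Module.Basis.span (isGabidulinVector_iff.1 hv)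

theorem IsGabidulinVector.coe_basis_apply {v : Fin m → K} (hv : IsGabidulinVector k v)
    (i : Fin m) : (hv.basis i : K) = v i :=
  congrArg Subtype.val (Module.Basis.span_apply (isGabidulinVector_iff.1 hv) i)

theorem mem_entrySpan (v : Fin m → K) (i : Fin m) : v i ∈ entrySpan k v :=
  Submodule.subset_span ⟨i, rfl⟩

theorem IsGabidulinVector.rightMul_apply_eq {v : Fin m → K} (hv : IsGabidulinVector k v)
    (H : Matrix (Fin m) (Fin m) k) (i : Fin m) :
    GabidulinLike.rightMul K H v i = Matrix.toLinAlgEquiv hv.basis H (hv.basis i) := by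
  rw [Matrix.toLinAlgEquiv_self, rightMul_apply]
  simp [hv.coe_basis_apply]

theorem IsGabidulinVector.rightMul_injective {v : Fin m → K} (hv : IsGabidulinVector k v)
    {H H' : Matrix (Fin m) (Fin m) k}
    (h : ∀ i, GabidulinLike.rightMul K H v i = GabidulinLike.rightMul K H' v i) : H = H' := by
  refine (Matrix.toLinAlgEquiv hv.basis).injective (hv.basis.ext fun i => Subtype.ext ?_)
  rw [← hv.rightMul_apply_eq, ← hv.rightMul_apply_eq, h]

/-- An element `b ∈ K` stabilizing `V` lies in the largest stabilizing intermediate field. -/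
theorem mem_of_forall_mul_mem [FiniteDimensional k K] {V : Submodule k K}
    {M : IntermediateField k K}
    (hM : M ∈ upperBounds {E : IntermediateField k K | ∀ a ∈ E, ∀ x ∈ V, a * x ∈ V})
    {b : K} (hb : ∀ x ∈ V, b * x ∈ V) : b ∈ M := by
  let S : Subalgebra k K :=
    { carrier := {a | ∀ x ∈ V, a * x ∈ V}
      mul_mem' := fun {a c} ha hc x hx => by rw [mul_assoc]; exact ha _ (hc _ hx)
      add_mem' := fun {a c} ha hc x hx => by rw [add_mul]; exact V.add_mem (ha _ hx) (hc _ hx)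
      algebraMap_mem' := fun r x hx => by
        rw [← Algebra.smul_def]
        exact V.smul_mem r hx }
  -- Since b is algebraic, k(b) = k[b], which lies in the stabilizing algebra S.
  have hE : IntermediateField.adjoin k {b} ∈
      {E : IntermediateField k K | ∀ a ∈ E, ∀ x ∈ V, a * x ∈ V} := by
    intro a ha
    have h1 : a ∈ (IntermediateField.adjoin k {b}).toSubalgebra := ha
    rw [IntermediateField.adjoin_simple_toSubalgebra_of_isAlgebraic
      (Algebra.IsAlgebraic.isAlgebraic b)] at h1
    have h2 : Algebra.adjoin k {b} ≤ S := Algebra.adjoin_le (Set.singleton_subset_iff.2 hb)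
    exact h2 h1
  exact hM hE (IntermediateField.mem_adjoin_simple_self k b)

/-! ### The twist group as image of the projection to Gal(F/k). -/

/-- The group of all `σ ∈ Gal(F/k)` such that `b σ(V) = V` for some nonzero `b ∈ F`. -/
def twistGroup (F : IntermediateField k K) (V : Submodule k K) : Subgroup (F ≃ₐ[k] F) where
  carrier := {σ | ∃ b : F, b ≠ 0 ∧ ∀ x : F, (x : K) ∈ V ↔ ((b * σ x : F) : K) ∈ V}
  one_mem' := ⟨1, one_ne_zero, fun x => by simp⟩
  mul_mem' := by
    rintro σ τ ⟨b, hb, h⟩ ⟨c, hc, h'⟩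
    refine ⟨b * σ c, mul_ne_zero hb ((map_ne_zero σ).2 hc), fun x => ?_⟩
    rw [h', h, map_mul, mul_assoc, AlgEquiv.mul_apply]
  inv_mem' := by
    rintro σ ⟨b, hb, h⟩
    -- The multiplier comes from inverting x ↦ bσ(x), which gives x ↦ σ⁻¹(b⁻¹)σ⁻¹(x).
    refine ⟨σ⁻¹ b⁻¹, (map_ne_zero σ⁻¹).2 (inv_ne_zero hb), fun x => ?_⟩
    have h1 : σ (σ⁻¹ b⁻¹ * σ⁻¹ x) = b⁻¹ * x := by
      rw [← map_mul]
      exact σ.apply_symm_apply _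
    rw [h (σ⁻¹ b⁻¹ * σ⁻¹ x), h1, mul_inv_cancel_left₀ hb]

/-- The `k`-linear map `x ↦ b σ(x)` of `K`, for an extension of `σ ∈ Gal(F/k)` to `K`. -/
noncomputable def twist [Normal k K] {F : IntermediateField k K} (b : F) (σ : F ≃ₐ[k] F) :
    K →ₗ[k] K :=
  LinearMap.mulLeft k (b : K) ∘ₗ (σ.liftNormal K).toLinearMap

theorem twist_coe [Normal k K] {F : IntermediateField k K} (b : F) (σ : F ≃ₐ[k] F) (x : F) :
    twist b σ (x : K) = ((b * σ x : F) : K) :=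
  congrArg ((b : K) * ·) (σ.liftNormal_commutes K x)

theorem twist_injective [Normal k K] {F : IntermediateField k K} {b : F} (hb : b ≠ 0)
    (σ : F ≃ₐ[k] F) : Function.Injective (twist (K := K) b σ) :=
  (mul_right_injective₀ (by simpa using hb : (b : K) ≠ 0)).comp (σ.liftNormal K).injective

/-- The map x ↦ bσ(x) sends v to vh, whose entries lie in V_v; being injective, it maps V_v onto
itself. -/
theorem IsSemilinearPair.mem_twistGroup [FiniteDimensional k K] [Normal k K]
    {F : IntermediateField k K} {B : Module.Basis (Fin ℓ) k K} {v : Fin m → K}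
    {hvF : ∀ i, v i ∈ F} {p : GL (Fin ℓ) k × GL (Fin m) k} {σ : F ≃ₐ[k] F}
    (h : IsSemilinearPair B hvF p σ) : σ ∈ twistGroup F (entrySpan k v) := by
  obtain ⟨-, b, hb, hw⟩ := h
  refine ⟨b, hb, fun x => ?_⟩
  have hle : (entrySpan k v).map (twist b σ) ≤ entrySpan k v := by
    rw [Submodule.map_le_iff_le_comap]
    refine Submodule.span_le.2 ?_
    rintro _ ⟨i, rfl⟩
    have h1 : twist b σ (v i) = rightMul K (p.2 : Matrix (Fin m) (Fin m) k) v i :=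
      (twist_coe b σ ⟨v i, hvF i⟩).trans (hw i).symm
    change twist b σ (v i) ∈ entrySpan k v
    rw [h1, rightMul_apply]
    exact sum_mem fun j _ => Submodule.smul_mem _ _ (mem_entrySpan v j)
  have heq := Submodule.eq_of_le_of_finrank_eq hle
    (Submodule.equivMapOfInjective _ (twist_injective hb σ) _).finrank_eq.symm
  rw [← twist_coe]
  conv_rhs => rw [← heq]
  exact ((twist_injective hb σ).mem_set_image (s := (entrySpan k v : Set K))).symm

/-- Surjectivity onto the twist group: take for g an extension of σ to K, and for h the matrix of x
↦ bσ(x) on V_v in the basis v. -/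
theorem exists_isSemilinearPair_of_mem_twistGroup [FiniteDimensional k K] [Normal k K]
    {F : IntermediateField k K} (B : Module.Basis (Fin ℓ) k K) {v : Fin m → K}
    (hv : IsGabidulinVector k v) (hvF : ∀ i, v i ∈ F) {σ : F ≃ₐ[k] F}
    (hσ : σ ∈ twistGroup F (entrySpan k v)) :
    ∃ p : GL (Fin ℓ) k × GL (Fin m) k, IsSemilinearPair B hvF p σ := by
  obtain ⟨b, hb, hbV⟩ := hσ
  obtain ⟨g, hg⟩ := exists_GL_toLinAlgEquiv_eq B (σ.liftNormal K).toLinearMap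
    (σ.liftNormal K).injective
  have hVF : ∀ x ∈ entrySpan k v, x ∈ F := fun x hx => by
    have : entrySpan k v ≤ F.toSubalgebra.toSubmodule := Submodule.span_le.2 (by
      rintro _ ⟨i, rfl⟩
      exact hvF i)
    exact this hx
  have hmap : ∀ x ∈ entrySpan k v, twist b σ x ∈ entrySpan k v := fun x hx => by
    have h1 := (hbV ⟨x, hVF x hx⟩).1 hx
    rwa [← twist_coe] at h1
  obtain ⟨h, hh⟩ := exists_GL_toLinAlgEquiv_eq hv.basis ((twist b σ).restrict hmap)
    (fun x y hxy => Subtype.ext (twist_injective hb σ (congrArg Subtype.val hxy)))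
  refine ⟨(g, h), fun x y => ?_, b, hb, fun i => ?_⟩
  · rw [hg]
    exact (map_mul (σ.liftNormal K) _ _).trans (congrArg (· * _) (σ.liftNormal_commutes K x))
  · rw [hv.rightMul_apply_eq, hh, LinearMap.coe_restrict_apply, hv.coe_basis_apply]
    exact twist_coe b σ ⟨v i, hvF i⟩

/-- Evaluate at 1, where the injective g is nonzero. Hence σ is a function of the pair, and the
projection is multiplicative. -/
theorem IsSemilinear.unique {F : IntermediateField k K} {B : Module.Basis (Fin ℓ) k K}
    {g : GL (Fin ℓ) k} {σ τ : F ≃ₐ[k] F} (hσ : IsSemilinear B g σ) (hτ : IsSemilinear B g τ) :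
    σ = τ := by
  ext x
  have h1 := (hσ x 1).symm.trans (hτ x 1)
  have h0 : Matrix.toLinAlgEquiv B (g : Matrix (Fin ℓ) (Fin ℓ) k) 1 ≠ 0 := fun h =>
    one_ne_zero (toLinAlgEquiv_injective B g (h.trans (map_zero _).symm))
  exact mul_right_cancel₀ h0 h1

theorem IsSemilinear.mul {F : IntermediateField k K} {B : Module.Basis (Fin ℓ) k K}
    {g g' : GL (Fin ℓ) k} {σ τ : F ≃ₐ[k] F} (hσ : IsSemilinear B g σ)
    (hτ : IsSemilinear B g' τ) : IsSemilinear B (g * g') (σ * τ) := by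
  intro x y
  rw [Units.val_mul, map_mul (Matrix.toLinAlgEquiv B), Module.End.mul_apply, Module.End.mul_apply, hτ, hσ,
    AlgEquiv.mul_apply]

/-! ### The kernel GL_s(F) × Mˣ and the exact sequence. -/

/-- Restriction of scalars as a monoid homomorphism of endomorphism rings. -/
def endRestrictScalars (F : IntermediateField k K) : Module.End F K →* Module.End k K where
  toFun f := f.restrictScalars k
  map_one' := rfl
  map_mul' _ _ := rfl

/-- The embedding of `GL_s(F)` into `GL_ℓ(k)` as the group of `F`-linear automorphisms of `K`. -/
noncomputable def glRestrictScalars [FiniteDimensional k K] (B : Module.Basis (Fin ℓ) k K)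
    (F : IntermediateField k K) : GL (Fin (Module.finrank F K)) F →* GL (Fin ℓ) k :=
  Units.map (((LinearMap.toMatrixAlgEquiv B : Module.End k K →* Matrix (Fin ℓ) (Fin ℓ) k).comp
    (endRestrictScalars F)).comp
      (Matrix.toLinAlgEquiv (Module.finBasis F K) :
        Matrix (Fin (Module.finrank F K)) (Fin (Module.finrank F K)) F →* Module.End F K))

theorem toLinAlgEquiv_glRestrictScalars [FiniteDimensional k K] (B : Module.Basis (Fin ℓ) k K)
    (F : IntermediateField k K) (A : GL (Fin (Module.finrank F K)) F) (y : K) :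
    Matrix.toLinAlgEquiv B (glRestrictScalars B F A : Matrix (Fin ℓ) (Fin ℓ) k) y =
      Matrix.toLinAlgEquiv (Module.finBasis F K)
        (A : Matrix (Fin (Module.finrank F K)) (Fin (Module.finrank F K)) F) y :=
  LinearMap.congr_fun (Matrix.toLinAlgEquiv_toMatrixAlgEquiv B _) y

theorem glRestrictScalars_injective [FiniteDimensional k K] (B : Module.Basis (Fin ℓ) k K)
    (F : IntermediateField k K) : Function.Injective (glRestrictScalars B F) := by
  intro A A' h
  refine Units.ext ((Matrix.toLinAlgEquiv (Module.finBasis F K)).injective ?_)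
  ext y
  rw [← toLinAlgEquiv_glRestrictScalars B, h, toLinAlgEquiv_glRestrictScalars]

/-- The multiplication action of an intermediate field `M` on a stable subspace. -/
def mulHom {M : IntermediateField k K} {V : Submodule k K}
    (hM : ∀ a ∈ M, ∀ x ∈ V, a * x ∈ V) : M →* Module.End k V where
  toFun a := (LinearMap.mulLeft k (a : K)).restrict (hM a a.2)
  map_one' := by ext; simp
  map_mul' a b := LinearMap.ext fun x => Subtype.ext (mul_assoc (a : K) b x)

/-- The action of `Mˣ` on `V_v`, as matrices with respect to `v`. -/
noncomputable def unitsToGL {v : Fin m → K} (hv : IsGabidulinVector k v)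
    {M : IntermediateField k K} (hM : ∀ a ∈ M, ∀ x ∈ entrySpan k v, a * x ∈ entrySpan k v) :
    Mˣ →* GL (Fin m) k :=
  Units.map ((LinearMap.toMatrixAlgEquiv hv.basis :
    Module.End k (entrySpan k v) →* Matrix (Fin m) (Fin m) k).comp (mulHom hM))

theorem rightMul_unitsToGL {v : Fin m → K} (hv : IsGabidulinVector k v)
    {M : IntermediateField k K} (hM : ∀ a ∈ M, ∀ x ∈ entrySpan k v, a * x ∈ entrySpan k v)
    (b : Mˣ) (i : Fin m) :
    rightMul K (unitsToGL hv hM b : Matrix (Fin m) (Fin m) k) v i = ((b : M) : K) * v i := by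
  rw [hv.rightMul_apply_eq]
  change (Matrix.toLinAlgEquiv hv.basis (LinearMap.toMatrixAlgEquiv hv.basis (mulHom hM b))
    (hv.basis i) : K) = _
  rw [Matrix.toLinAlgEquiv_toMatrixAlgEquiv, ← hv.coe_basis_apply]
  rfl

/-- If a group `A` of pairs consists of the semilinear pairs, then it is an extension of the
twist group by `GL_s(F) × Mˣ`. -/
theorem nonempty_groupExtension [FiniteDimensional k K] [Normal k K] [NeZero m]
    (B : Module.Basis (Fin ℓ) k K) {v : Fin m → K} (hv : IsGabidulinVector k v) (hv1 : v 0 = 1)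
    {F : IntermediateField k K} (hvF : ∀ i, v i ∈ F) {M : IntermediateField k K}
    (hM : IsGreatest {E : IntermediateField k K |
      ∀ a ∈ E, ∀ x ∈ entrySpan k v, a * x ∈ entrySpan k v} M)
    (A : Subgroup (GL (Fin ℓ) k × GL (Fin m) k))
    (hA : ∀ p, p ∈ A ↔ ∃ σ : F ≃ₐ[k] F, IsSemilinearPair B hvF p σ) :
    Nonempty (GroupExtension (GL (Fin (Module.finrank F K)) F × Mˣ) A
      (twistGroup F (entrySpan k v))) := by
  -- As 1 = `v 0` lies in V_v, M = M·1 ⊆ V_v ⊆ F.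
  have hMF : ∀ a ∈ M, a ∈ F := by
    intro a ha
    have h1 : entrySpan k v ≤ F.toSubalgebra.toSubmodule := Submodule.span_le.2 (by
      rintro _ ⟨i, rfl⟩
      exact hvF i)
    have h2 := h1 (hM.1 a ha _ (mem_entrySpan v 0))
    rwa [hv1, mul_one] at h2
  choose s hs using fun p : A => (hA p).1 p.2
  let r : A →* twistGroup F (entrySpan k v) :=
    MonoidHom.mk' (fun p => ⟨s p, (hs p).mem_twistGroup⟩) fun p q =>
      Subtype.ext ((hs (p * q)).1.unique ((hs p).1.mul (hs q).1))
  have hinl : ∀ q : GL (Fin (Module.finrank F K)) F × Mˣ,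
      IsSemilinearPair B hvF (glRestrictScalars B F q.1, unitsToGL hv hM.1 q.2) 1 := by
    intro q
    refine ⟨fun x y => ?_, ⟨((q.2 : M) : K), hMF _ (q.2 : M).2⟩, fun h0 => ?_, fun i => ?_⟩
    · rw [toLinAlgEquiv_glRestrictScalars, toLinAlgEquiv_glRestrictScalars]
      exact map_smul (Matrix.toLinAlgEquiv (Module.finBasis F K) _) x y
    · have h1 : ((q.2 : M) : K) = 0 := congrArg Subtype.val h0
      exact q.2.ne_zero (Subtype.ext h1)
    · exact rightMul_unitsToGL hv hM.1 q.2 i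
  let j : GL (Fin (Module.finrank F K)) F × Mˣ →* A :=
    ((glRestrictScalars B F).prodMap (unitsToGL hv hM.1)).codRestrict A
      fun q => (hA _).2 ⟨1, hinl q⟩
  refine ⟨⟨j, r, ?_, ?_, ?_⟩⟩
  · rintro ⟨a, b⟩ ⟨a', b'⟩ h
    have h1 : (glRestrictScalars B F a, unitsToGL hv hM.1 b) =
      (glRestrictScalars B F a', unitsToGL hv hM.1 b') := congrArg Subtype.val h
    obtain ⟨h2, h3⟩ := Prod.mk.inj h1
    refine Prod.ext (glRestrictScalars_injective B F h2) (Units.ext (Subtype.ext ?_))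
    have h4 := rightMul_unitsToGL hv hM.1 b 0
    rw [h3, rightMul_unitsToGL hv hM.1 b' 0, hv1, mul_one, mul_one] at h4
    exact h4.symm
  · ext p
    constructor
    · rintro ⟨q, rfl⟩
      exact Subtype.ext ((hs (j q)).1.unique (hinl q).1)
    · intro hp
      have hp1 : s p = 1 := congrArg Subtype.val hp
      obtain ⟨hlin, b, hb, hw⟩ := hs p
      rw [hp1] at hlin hw
      obtain ⟨a, ha⟩ := exists_GL_toLinAlgEquiv_eq (Module.finBasis F K)
        { toFun := Matrix.toLinAlgEquiv B (p.1.1 : Matrix (Fin ℓ) (Fin ℓ) k)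
          map_add' := map_add _
          map_smul' := hlin } (toLinAlgEquiv_injective B p.1.1)
      -- For σ = 1 the condition on h reads vh = bv, so b stabilizes V_v.
      have hbV : ∀ x ∈ entrySpan k v, (b : K) * x ∈ entrySpan k v := by
        have hle : entrySpan k v ≤ (entrySpan k v).comap (LinearMap.mulLeft k (b : K)) := by
          refine Submodule.span_le.2 ?_
          rintro _ ⟨i, rfl⟩
          have h1 : (b : K) * v i = rightMul K (p.1.2 : Matrix (Fin m) (Fin m) k) v i :=
            (hw i).symm
          change (b : K) * v i ∈ entrySpan k v
          rw [h1, rightMul_apply]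
          exact sum_mem fun j _ => Submodule.smul_mem _ _ (mem_entrySpan v j)
        exact fun x hx => hle hx
      have hbM : (b : K) ∈ M := mem_of_forall_mul_mem hM.2 hbV
      have hb0 : (⟨b, hbM⟩ : M) ≠ 0 := fun h0 => by
        have h1 : (b : K) = 0 := congrArg Subtype.val h0
        exact hb (Subtype.ext h1)
      let b' : Mˣ := Units.mk0 ⟨b, hbM⟩ hb0
      refine ⟨(a, b'), Subtype.ext (Prod.ext (Units.ext ?_) (Units.ext ?_))⟩
      · refine (Matrix.toLinAlgEquiv B).injective (LinearMap.ext fun y => ?_)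
        exact (toLinAlgEquiv_glRestrictScalars B F a y).trans (LinearMap.congr_fun ha y)
      · exact hv.rightMul_injective fun i => (rightMul_unitsToGL hv hM.1 b' i).trans (hw i).symm
  · rintro ⟨σ, hσ⟩
    obtain ⟨p, hp⟩ := exists_isSemilinearPair_of_mem_twistGroup B hv hvF hσ
    exact ⟨⟨p, (hA p).2 ⟨σ, hp⟩⟩, Subtype.ext ((hs _).1.unique hp.1)⟩

/-! ### The cyclic Galois group and the main theorem. -/

/-- An element fixed by a generator of the Galois group lies in the base field. -/
theorem mem_range_algebraMap_of_fixed [FiniteDimensional k K] [IsGalois k K] {θ : K ≃ₐ[k] K}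
    (hθ : ∀ σ : K ≃ₐ[k] K, σ ∈ Subgroup.zpowers θ) {x : K} (hx : θ x = x) :
    x ∈ Set.range (algebraMap k K) := by
  rw [← IntermediateField.mem_bot, IsGalois.mem_bot_iff_fixed]
  intro σ
  have h : Subgroup.zpowers θ ≤ MulAction.stabilizer (K ≃ₐ[k] K) x :=
    (Subgroup.zpowers_le).2 hx
  exact h (hθ σ)

end GabidulinLike

theorem mainTheorem1 {k K : Type*} [Field k] [Field K] [Algebra k K] [IsGalois k K]
    {ℓ m : ℕ} [NeZero m]
    (B : Module.Basis (Fin ℓ) k K)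
    (θ : K ≃ₐ[k] K) (hθ : ∀ σ : K ≃ₐ[k] K, σ ∈ Subgroup.zpowers θ)
    (v : Fin m → K) (hv : GabidulinLike.IsGabidulinVector k v) (hv1 : v 0 = 1)
    (M : IntermediateField k K)
    (hM : IsGreatest {E : IntermediateField k K |
      ∀ a ∈ E, ∀ x ∈ GabidulinLike.entrySpan k v, a * x ∈ GabidulinLike.entrySpan k v} M)
    (F : IntermediateField k K)
    (hF : F.toSubalgebra = Algebra.adjoin k (v '' {i | i ≠ 0})) :
    IsLeast {E : IntermediateField k K |
      ∀ x ∈ GabidulinLike.entrySpan k v, x ∈ E} F ∧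
    (∃ τ : F ≃ₐ[k] F, (∀ x : F, (τ x : K) = θ (x : K)) ∧
      Subgroup.zpowers τ = ⊤) ∧
    ∃ G : Subgroup (F ≃ₐ[k] F), ∀ d : ℕ, 1 ≤ d → d < m →
      Nonempty (GroupExtension
        (GL (Fin (Module.finrank F K)) F × Mˣ)
        (GabidulinLike.codeAut (GabidulinLike.code B v θ d)) G) := by
  have : FiniteDimensional k K := B.finiteDimensional_of_finite
  have : IsCyclic (K ≃ₐ[k] K) := ⟨θ, hθ⟩
  have : IsAbelianGalois k K := .of_isCyclic k K
  have hvF : ∀ i, v i ∈ F := by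
    intro i
    by_cases hi : i = 0
    · rw [hi, hv1]
      exact one_mem F
    · have h1 : v i ∈ Algebra.adjoin k (v '' {i | i ≠ 0}) := Algebra.subset_adjoin ⟨i, hi, rfl⟩
      rwa [← hF] at h1
  have hF' : F.toSubalgebra = Algebra.adjoin k (Set.range v) := by
    refine le_antisymm ?_ (Algebra.adjoin_le ?_)
    · rw [hF]
      exact Algebra.adjoin_mono (Set.image_subset_range _ _)
    · rintro _ ⟨i, rfl⟩
      exact hvF i
  refine ⟨⟨fun x hx => ?_, fun E hE => ?_⟩, ⟨θ.restrictNormal F, θ.restrictNormal_commutes F, ?_⟩,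
    GabidulinLike.twistGroup F (GabidulinLike.entrySpan k v), fun d hd hdm => ?_⟩
  · have h1 : GabidulinLike.entrySpan k v ≤ F.toSubalgebra.toSubmodule := Submodule.span_le.2 (by
      rintro _ ⟨i, rfl⟩
      exact hvF i)
    exact h1 hx
  · have h1 : F.toSubalgebra ≤ E.toSubalgebra := by
      rw [hF', Algebra.adjoin_le_iff]
      rintro _ ⟨i, rfl⟩
      exact hE _ (GabidulinLike.mem_entrySpan v i)
    exact h1
  · rw [eq_top_iff]
    intro σ _
    -- Restriction Gal(K/k) → Gal(F/k) is onto, so it carries the generator θ to a generator.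
    obtain ⟨τ, rfl⟩ := AlgEquiv.restrictNormalHom_surjective (F := k) (K₁ := F) K σ
    obtain ⟨n, rfl⟩ := hθ τ
    exact ⟨n, (map_zpow (AlgEquiv.restrictNormalHom F) θ n).symm⟩
  · exact GabidulinLike.nonempty_groupExtension B hv hv1 hvF hM _ fun p =>
      GabidulinLike.mem_codeAut_iff B (fun _ => GabidulinLike.mem_range_algebraMap_of_fixed hθ)
        hv hv1 hF' hvF hd hdm p
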